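/- Let $D\subset\mathbb{R}^d$ be a compact set contained in the closure of its interior. Let $\mathcal{F}=C^\infty(D,\mathbb{R})$ be the algebra of continuous functions $f:D\to\mathbb{R}$ that are smooth on the interior of $D$ and all of whose iterated partial derivatives extend continuously from the interior to $D$; for $f\in\mathcal F$, the partial derivative $\partial_{x_i}f\in\mathcal{F}$ denotes this continuous extension. Let $B$ be an $\ell\times\ell''$ matrix over one of the following rings $R$, acting as a linear operator $B:\mathcal{F}^{\ell''}\to\mathcal{F}^{\ell}$: 1. $R=\mathbb{R}[\partial_{x_1},\dots,\partial_{x_d}]$, the polynomial ring of differential operators with constant coefficients, acting by partial derivatives; 2. $R=\mathbb{R}[f_1,\dots,f_n]\subseteq\mathcal{F}$ for some $f_1,\dots,f_n\in\mathcal{F}$, acting by multiplication; 3. the Weyl algebra $R=\mathbb{R}[F]\langle\partial_{x_1},\dots,\partial_{x_d}\rangle$ for an $\mathbb{R}$-subalgebra $F\subseteq\mathcal{F}$ closed under partial derivatives, with commuting $\partial_{x_i}$ and the relations $\partial_{x_i}f=f\partial_{x_i}+\frac{\partial f}{\partial x_i}$ for $f\in F$, where $F$ acts by multiplication and $\partial_{x_i}$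 by partial derivatives. Let $g=\mathcal{GP}(\mu,k)$ be an $\mathbb{R}^{\ell''}$-valued Gaussian process on $D$ with mean function $\mu(x)=E(g(x))$ and covariance function $k(x,x')=E\big((g(x)-\mu(x))(g(x')-\mu(x'))^T\big)$, whose realizations lie almost surely in $\mathcal{F}^{\ell''}$. Then $\mu\in\mathcal{F}^{\ell''}$, the entries of $k(\cdot,x')$ lie in $\mathcal{F}$ for every $x'\in D$, the entries of $x'\mapsto Bk(x,x')$ (with $B$ acting on the columns of $k$ as functions of $x$) lie in $\mathcal{F}$ for every $x\in D$, and the pushforward process $B_*g$, with realizations $B(g(\cdot))$, is again a Gaussian process, namely $$B_*g=\mathcal{GP}\big(B\mu(x),\,Bk(x,x')(B')^T\big),$$ where $B'$ denotes the operation of $B$ on functions with argument $x'$ (applied to the rows of $Bk(x,x')$). -/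

import Mathlib

open MeasureTheory ProbabilityTheory Set
open scoped ContDiff

namespace GPPush

/-- The ambient space `ℝ^d`. -/
abbrev Eucl (d : ℕ) : Type := EuclideanSpace ℝ (Fin d)

variable {d : ℕ}

section SmoothFunctions

/-- Extension by zero of a function on `D`; only its values on the open set `interior D`
are ever used. -/
noncomputable def zeroExt (D : Set (Eucl d)) (f : D → ℝ) : Eucl d → ℝ :=
  Function.extend Subtype.val f 0

/-- The partial derivative in the `i`-th coordinate direction of a function on `ℝ^d`. -/
noncomputable def pderiv (i : Fin d) (F : Eucl d → ℝ) : Eucl d → ℝ :=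
  fun x => fderiv ℝ F x (EuclideanSpace.single i 1)

/-- Iterated partial derivatives along a list of coordinate directions. -/
noncomputable def iterPDeriv : List (Fin d) → (Eucl d → ℝ) → (Eucl d → ℝ)
  | [], F => F
  | i :: L, F => iterPDeriv L (pderiv i F)

/-- A function on `D` is smooth if it is continuous on `D`, smooth on the interior of `D`, and
each of its iterated partial derivatives extends continuously from the interior to `D`. -/
structure IsSmooth (D : Set (Eucl d)) (f : D → ℝ) : Prop where
  continuous : Continuous f
  contDiffOn : ContDiffOn ℝ ∞ (zeroExt D f) (interior D)
  extends_deriv : ∀ L : List (Fin d), ∃ h : D → ℝ, Continuous h ∧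
    ∀ x : D, (x : Eucl d) ∈ interior D → h x = iterPDeriv L (zeroExt D f) x

lemma zeroExt_apply {D : Set (Eucl d)} (f : D → ℝ) (x : D) : zeroExt D f x = f x :=
  Subtype.val_injective.extend_apply f 0 x

lemma pderiv_congr {U : Set (Eucl d)} (hU : IsOpen U) {F G : Eucl d → ℝ} (h : EqOn F G U)
    (i : Fin d) : EqOn (pderiv i F) (pderiv i G) U := by
  intro x hx
  have : F =ᶠ[nhds x] G := Filter.eventuallyEq_of_mem (hU.mem_nhds hx) h
  simp [pderiv, this.fderiv_eq]

lemma iterPDeriv_congr {U : Set (Eucl d)} (hU : IsOpen U) (L : List (Fin d)) :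
    ∀ {F G : Eucl d → ℝ}, EqOn F G U → EqOn (iterPDeriv L F) (iterPDeriv L G) U := by
  induction L with
  | nil => intro F G h; exact h
  | cons i L ih => intro F G h; exact ih (pderiv_congr hU h i)

lemma contDiffOn_pderiv {U : Set (Eucl d)} (hU : IsOpen U) {F : Eucl d → ℝ}
    (h : ContDiffOn ℝ ∞ F U) (i : Fin d) : ContDiffOn ℝ ∞ (pderiv i F) U :=
  (h.fderiv_of_isOpen hU (m := ∞) (by simp)).clm_apply contDiffOn_const

lemma differentiableAt_of {U : Set (Eucl d)} (hU : IsOpen U) {F : Eucl d → ℝ}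
    (h : ContDiffOn ℝ ∞ F U) {x : Eucl d} (hx : x ∈ U) : DifferentiableAt ℝ F x :=
  (h.contDiffAt (hU.mem_nhds hx)).differentiableAt (by simp)

lemma pderiv_add {U : Set (Eucl d)} (hU : IsOpen U) {F G : Eucl d → ℝ}
    (hF : ContDiffOn ℝ ∞ F U) (hG : ContDiffOn ℝ ∞ G U) (i : Fin d) :
    EqOn (pderiv i (F + G)) (pderiv i F + pderiv i G) U := by
  intro x hx
  simp [pderiv, fderiv_add (differentiableAt_of hU hF hx) (differentiableAt_of hU hG hx)]

lemma pderiv_mul {U : Set (Eucl d)} (hU : IsOpen U) {F G : Eucl d → ℝ}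
    (hF : ContDiffOn ℝ ∞ F U) (hG : ContDiffOn ℝ ∞ G U) (i : Fin d) :
    EqOn (pderiv i (F * G)) (F * pderiv i G + pderiv i F * G) U := by
  intro x hx
  simp [pderiv, fderiv_mul (differentiableAt_of hU hF hx) (differentiableAt_of hU hG hx)]
  ring

lemma iterPDeriv_add {U : Set (Eucl d)} (hU : IsOpen U) (L : List (Fin d)) :
    ∀ {F G : Eucl d → ℝ}, ContDiffOn ℝ ∞ F U → ContDiffOn ℝ ∞ G U →
      EqOn (iterPDeriv L (F + G)) (iterPDeriv L F + iterPDeriv L G) U := by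
  induction L with
  | nil => intro F G _ _ x _; rfl
  | cons i L ih =>
    intro F G hF hG
    exact (iterPDeriv_congr hU L (pderiv_add hU hF hG i)).trans
      (ih (contDiffOn_pderiv hU hF i) (contDiffOn_pderiv hU hG i))

lemma zeroExt_add (D : Set (Eucl d)) (f g : D → ℝ) :
    EqOn (zeroExt D (f + g)) (zeroExt D f + zeroExt D g) (interior D) := by
  intro x hx
  lift x to D using interior_subset hx
  simp [zeroExt_apply]

lemma zeroExt_mul (D : Set (Eucl d)) (f g : D → ℝ) :
    EqOn (zeroExt D (f * g)) (zeroExt D f * zeroExt D g) (interior D) := by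
  intro x hx
  lift x to D using interior_subset hx
  simp [zeroExt_apply]

lemma iterPDeriv_const (U : Set (Eucl d)) (hU : IsOpen U) (L : List (Fin d)) :
    ∀ c : ℝ, ∃ e : ℝ, EqOn (iterPDeriv L (fun _ => c)) (fun _ => e) U := by
  induction L with
  | nil => intro c; exact ⟨c, fun _ _ => rfl⟩
  | cons i L ih =>
    intro c
    obtain ⟨e, he⟩ := ih 0
    refine ⟨e, fun x hx => ?_⟩
    rw [← he hx]
    exact iterPDeriv_congr hU L (fun y _ => by simp [pderiv]) hx

lemma IsSmooth.const (D : Set (Eucl d)) (c : ℝ) : IsSmooth D (fun _ => c) := by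
  have h0 : EqOn (zeroExt D (fun _ => c)) (fun _ => c) (interior D) := by
    intro x hx
    lift x to D using interior_subset hx
    simp [zeroExt_apply]
  refine ⟨continuous_const, contDiffOn_const.congr h0, fun L => ?_⟩
  obtain ⟨e, he⟩ := iterPDeriv_const (interior D) isOpen_interior L c
  exact ⟨fun _ => e, continuous_const, fun x hx =>
    ((iterPDeriv_congr isOpen_interior L h0).trans he hx).symm⟩

lemma IsSmooth.add {D : Set (Eucl d)} {f g : D → ℝ} (hf : IsSmooth D f) (hg : IsSmooth D g) :
    IsSmooth D (f + g) := by
  refine ⟨hf.continuous.add hg.continuous,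
    (hf.contDiffOn.add hg.contDiffOn).congr (zeroExt_add D f g), fun L => ?_⟩
  obtain ⟨a, ha, ha'⟩ := hf.extends_deriv L
  obtain ⟨b, hb, hb'⟩ := hg.extends_deriv L
  refine ⟨a + b, ha.add hb, fun x hx => ?_⟩
  rw [(iterPDeriv_congr isOpen_interior L (zeroExt_add D f g)).trans
    (iterPDeriv_add isOpen_interior L hf.contDiffOn hg.contDiffOn) hx]
  simp [ha' x hx, hb' x hx]

/-- Partial derivatives of smooth functions on `D` exist as smooth functions on `D`. -/
lemma IsSmooth.exists_pderiv {D : Set (Eucl d)} {f : D → ℝ} (hf : IsSmooth D f) (i : Fin d) :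
    ∃ h : D → ℝ, IsSmooth D h ∧ EqOn (zeroExt D h) (pderiv i (zeroExt D f)) (interior D) := by
  obtain ⟨h, hc, he⟩ := hf.extends_deriv [i]
  have h1 : EqOn (zeroExt D h) (pderiv i (zeroExt D f)) (interior D) := by
    intro x hx
    lift x to D using interior_subset hx
    rw [zeroExt_apply, he x hx]
    rfl
  refine ⟨h, ⟨hc, (contDiffOn_pderiv isOpen_interior hf.contDiffOn i).congr h1, fun L => ?_⟩, h1⟩
  obtain ⟨a, ha, ha'⟩ := hf.extends_deriv (i :: L)
  exact ⟨a, ha, fun x hx => by rw [ha' x hx, iterPDeriv_congr isOpen_interior L h1 hx]; rfl⟩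

lemma IsSmooth.mul {D : Set (Eucl d)} {f g : D → ℝ} (hf : IsSmooth D f) (hg : IsSmooth D g) :
    IsSmooth D (f * g) := by
  refine ⟨hf.continuous.mul hg.continuous,
    (hf.contDiffOn.mul hg.contDiffOn).congr (zeroExt_mul D f g), fun L => ?_⟩
  induction L generalizing f g with
  | nil =>
    exact ⟨f * g, hf.continuous.mul hg.continuous, fun x _ => (zeroExt_apply _ x).symm⟩
  | cons i L ih =>
    obtain ⟨f', hf', ef⟩ := hf.exists_pderiv i
    obtain ⟨g', hg', eg⟩ := hg.exists_pderiv i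
    obtain ⟨a, ha, ha'⟩ := ih hf hg'
    obtain ⟨b, hb, hb'⟩ := ih hf' hg
    refine ⟨a + b, ha.add hb, fun x hx => ?_⟩
    have e1 : EqOn (pderiv i (zeroExt D (f * g)))
        (zeroExt D (f * g') + zeroExt D (f' * g)) (interior D) := by
      intro y hy
      rw [pderiv_congr isOpen_interior (zeroExt_mul D f g) i hy,
        pderiv_mul isOpen_interior hf.contDiffOn hg.contDiffOn i hy]
      simp only [Pi.add_apply, Pi.mul_apply, zeroExt_mul D f g' hy, zeroExt_mul D f' g hy,
        ef hy, eg hy]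
    have e2 := (iterPDeriv_congr isOpen_interior L e1).trans
      (iterPDeriv_add isOpen_interior L
        ((hf.contDiffOn.mul hg'.contDiffOn).congr (zeroExt_mul D f g'))
        ((hf'.contDiffOn.mul hg.contDiffOn).congr (zeroExt_mul D f' g)))
    change (a + b) x = iterPDeriv L (pderiv i (zeroExt D (f * g))) x
    rw [e2 hx]
    simp [ha' x hx, hb' x hx]

/-- The algebra `C^∞(D, ℝ)` of smooth functions on `D`. -/
def SmoothFun (D : Set (Eucl d)) : Subalgebra ℝ (D → ℝ) where
  carrier := {f | IsSmooth D f}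
  mul_mem' := IsSmooth.mul
  add_mem' := IsSmooth.add
  algebraMap_mem' := IsSmooth.const D

/-- A continuous function on `D` is determined by its values on the interior, if this is
dense in `D`. -/
lemma eq_of_eqOn_interior {D : Set (Eucl d)} (hD : D ⊆ closure (interior D)) {f g : D → ℝ}
    (hf : Continuous f) (hg : Continuous g)
    (h : ∀ x : D, (x : Eucl d) ∈ interior D → f x = g x) : f = g := by
  refine hf.ext_on (s := {x : D | (x : Eucl d) ∈ interior D}) ?_ hg h
  intro x
  rw [closure_subtype]
  have : (Subtype.val '' {x : D | (x : Eucl d) ∈ interior D}) = interior D := by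
    ext y
    constructor
    · rintro ⟨z, hz, rfl⟩; exact hz
    · intro hy; exact ⟨⟨y, interior_subset hy⟩, hy, rfl⟩
  rw [this]
  exact hD x.2

lemma SmoothFun.ext_interior {D : Set (Eucl d)} (hD : D ⊆ closure (interior D))
    {f g : SmoothFun D}
    (h : EqOn (zeroExt D f) (zeroExt D g) (interior D)) : f = g :=
  Subtype.ext (eq_of_eqOn_interior hD f.2.continuous g.2.continuous fun x hx => by
    simpa [zeroExt_apply] using h hx)

/-- The partial derivative of a smooth function on `D`, as a function on `D`. -/
noncomputable def partialFun {D : Set (Eucl d)} (i : Fin d) (f : SmoothFun D) : SmoothFun D :=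
  ⟨(f.2.exists_pderiv i).choose, (f.2.exists_pderiv i).choose_spec.1⟩

lemma partialFun_eqOn {D : Set (Eucl d)} (i : Fin d) (f : SmoothFun D) :
    EqOn (zeroExt D (partialFun i f)) (pderiv i (zeroExt D f)) (interior D) :=
  (f.2.exists_pderiv i).choose_spec.2

/-- The partial derivative `∂_i` as a linear operator on `C^∞(D, ℝ)`: on the interior of `D` it is
the usual partial derivative, on the rest of `D` its continuous extension. -/
noncomputable def partialOp {D : Set (Eucl d)} (hD : D ⊆ closure (interior D)) (i : Fin d) :
    Module.End ℝ (SmoothFun D) where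
  toFun := partialFun i
  map_add' f g := by
    refine SmoothFun.ext_interior hD ?_
    intro x hx
    rw [partialFun_eqOn i (f + g) hx]
    change pderiv i (zeroExt D ((f : D → ℝ) + g)) x =
      zeroExt D ((partialFun i f : D → ℝ) + (partialFun i g : D → ℝ)) x
    rw [pderiv_congr isOpen_interior (zeroExt_add D f g) i hx, zeroExt_add D _ _ hx,
      pderiv_add isOpen_interior f.2.contDiffOn g.2.contDiffOn i hx]
    simp only [Pi.add_apply, partialFun_eqOn i f hx, partialFun_eqOn i g hx]
  map_smul' c f := by
    have hs : ∀ u : D → ℝ, EqOn (zeroExt D (c • u)) (c • zeroExt D u) (interior D) := by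
      intro u x hx
      lift x to D using interior_subset hx
      simp [zeroExt_apply]
    refine SmoothFun.ext_interior hD ?_
    intro x hx
    rw [partialFun_eqOn i (c • f) hx]
    change pderiv i (zeroExt D (c • (f : D → ℝ))) x =
      zeroExt D (c • (partialFun i f : D → ℝ)) x
    rw [pderiv_congr isOpen_interior (hs f) i hx, hs _ hx]
    simp only [Pi.smul_apply, partialFun_eqOn i f hx]
    simp [pderiv, fderiv_const_smul (differentiableAt_of isOpen_interior f.2.contDiffOn hx)]

lemma partialOp_eqOn {D : Set (Eucl d)} (hD : D ⊆ closure (interior D)) (i : Fin d)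
    (f : SmoothFun D) :
    EqOn (zeroExt D (partialOp hD i f)) (pderiv i (zeroExt D f)) (interior D) :=
  partialFun_eqOn i f

lemma partialOp_mul {D : Set (Eucl d)} (hD : D ⊆ closure (interior D)) (i : Fin d)
    (f g : SmoothFun D) :
    partialOp hD i (f * g) = f * partialOp hD i g + partialOp hD i f * g := by
  refine SmoothFun.ext_interior hD ?_
  intro x hx
  rw [partialOp_eqOn hD i (f * g) hx]
  change pderiv i (zeroExt D ((f : D → ℝ) * g)) x =
    zeroExt D ((f : D → ℝ) * (partialOp hD i g : D → ℝ) + (partialOp hD i f : D → ℝ) * g) x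
  rw [pderiv_congr isOpen_interior (zeroExt_mul D f g) i hx, zeroExt_add D _ _ hx,
    pderiv_mul isOpen_interior f.2.contDiffOn g.2.contDiffOn i hx]
  simp only [Pi.add_apply, Pi.mul_apply, zeroExt_mul D _ _ hx, partialOp_eqOn hD i f hx,
    partialOp_eqOn hD i g hx]

lemma partialOp_comm {D : Set (Eucl d)} (hD : D ⊆ closure (interior D)) (i j : Fin d) :
    partialOp hD i * partialOp hD j = partialOp hD j * partialOp hD i := by
  have key : ∀ (i j : Fin d) (f : SmoothFun D) (x : Eucl d), x ∈ interior D →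
      zeroExt D (partialOp hD i (partialOp hD j f)) x =
        fderiv ℝ (fderiv ℝ (zeroExt D f)) x (EuclideanSpace.single i 1)
          (EuclideanSpace.single j 1) := by
    intro i j f x hx
    rw [partialOp_eqOn hD i _ hx, pderiv_congr isOpen_interior (partialOp_eqOn hD j f) i hx]
    have h1 : DifferentiableAt ℝ (fderiv ℝ (zeroExt D f)) x :=
      ((f.2.contDiffOn.fderiv_of_isOpen isOpen_interior (m := ∞) (by simp)).contDiffAt
        (isOpen_interior.mem_nhds hx)).differentiableAt (by simp)
    change fderiv ℝ (fun y => fderiv ℝ (zeroExt D f) y (EuclideanSpace.single j 1)) x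
      (EuclideanSpace.single i 1) = _
    rw [fderiv_clm_apply h1 (differentiableAt_const _)]
    simp
  refine LinearMap.ext fun f => SmoothFun.ext_interior hD fun x hx => ?_
  rw [Module.End.mul_apply, Module.End.mul_apply, key i j f x hx, key j i f x hx]
  have hs : IsSymmSndFDerivAt ℝ (zeroExt D f) x :=
    (f.2.contDiffOn.contDiffAt (isOpen_interior.mem_nhds hx)).isSymmSndFDerivAt
      (by simp only [minSmoothness_of_isRCLikeNormedField]; exact ENat.LEInfty.out)
  exact hs _ _

end SmoothFunctions

section OperatorRings

/-- The multiplication operator of a smooth function. -/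
noncomputable def mulOp {D : Set (Eucl d)} (f : SmoothFun D) : Module.End ℝ (SmoothFun D) :=
  LinearMap.mulLeft ℝ f

/-- The action of `p ∈ ℝ[∂_1, …, ∂_d]` on `C^∞(D, ℝ)`: if `p = ∑ c_α X^α`, it is the operator
`∑ c_α ∂_1 ^ α_1 ⋯ ∂_d ^ α_d`. -/
noncomputable def constCoeffOp {D : Set (Eucl d)} (hD : D ⊆ closure (interior D))
    (p : MvPolynomial (Fin d) ℝ) : Module.End ℝ (SmoothFun D) :=
  ∑ α ∈ p.support, p.coeff α • (List.ofFn fun i => partialOp hD i ^ α i).prod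

/-- The relations of the Weyl algebra `ℝ[A]⟨∂_1, …, ∂_d⟩` on the generators `a ∈ A` and
`∂_1, …, ∂_d`: those of the algebra `A`, commutation of the `∂_i`, and
`∂_i a = a ∂_i + ∂a/∂x_i`. -/
inductive WeylRel {D : Set (Eucl d)} (hD : D ⊆ closure (interior D))
    (A : Subalgebra ℝ (SmoothFun D)) (hA : ∀ i, ∀ a ∈ A, partialOp hD i a ∈ A) :
    FreeAlgebra ℝ (A ⊕ Fin d) → FreeAlgebra ℝ (A ⊕ Fin d) → Prop
  | add (a b : A) : WeylRel hD A hA (FreeAlgebra.ι ℝ (Sum.inl (a + b)))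
      (FreeAlgebra.ι ℝ (Sum.inl a) + FreeAlgebra.ι ℝ (Sum.inl b))
  | mul (a b : A) : WeylRel hD A hA (FreeAlgebra.ι ℝ (Sum.inl (a * b)))
      (FreeAlgebra.ι ℝ (Sum.inl a) * FreeAlgebra.ι ℝ (Sum.inl b))
  | scalar (c : ℝ) : WeylRel hD A hA (FreeAlgebra.ι ℝ (Sum.inl (algebraMap ℝ A c)))
      (algebraMap ℝ (FreeAlgebra ℝ (A ⊕ Fin d)) c)
  | comm (i j : Fin d) : WeylRel hD A hA
      (FreeAlgebra.ι ℝ (Sum.inr i) * FreeAlgebra.ι ℝ (Sum.inr j))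
      (FreeAlgebra.ι ℝ (Sum.inr j) * FreeAlgebra.ι ℝ (Sum.inr i))
  | leibniz (i : Fin d) (a : A) : WeylRel hD A hA
      (FreeAlgebra.ι ℝ (Sum.inr i) * FreeAlgebra.ι ℝ (Sum.inl a))
      (FreeAlgebra.ι ℝ (Sum.inl a) * FreeAlgebra.ι ℝ (Sum.inr i) +
        FreeAlgebra.ι ℝ (Sum.inl ⟨partialOp hD i a, hA i a a.2⟩))

/-- The Weyl algebra `ℝ[A]⟨∂_1, …, ∂_d⟩` over a subalgebra `A` of `C^∞(D, ℝ)` that is closed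
under partial derivatives. -/
abbrev WeylAlg {D : Set (Eucl d)} (hD : D ⊆ closure (interior D))
    (A : Subalgebra ℝ (SmoothFun D)) (hA : ∀ i, ∀ a ∈ A, partialOp hD i a ∈ A) : Type :=
  RingQuot (WeylRel hD A hA)

/-- The action of the free algebra on `C^∞(D, ℝ)`: elements of `A` act by multiplication, `∂_i` by
partial differentiation. -/
noncomputable def freeAction {D : Set (Eucl d)} (hD : D ⊆ closure (interior D))
    (A : Subalgebra ℝ (SmoothFun D)) :
    FreeAlgebra ℝ (A ⊕ Fin d) →ₐ[ℝ] Module.End ℝ (SmoothFun D) :=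
  FreeAlgebra.lift ℝ (Sum.elim (fun a : A => mulOp (a : SmoothFun D)) (partialOp hD))

lemma freeAction_rel {D : Set (Eucl d)} (hD : D ⊆ closure (interior D))
    (A : Subalgebra ℝ (SmoothFun D)) (hA : ∀ i, ∀ a ∈ A, partialOp hD i a ∈ A)
    ⦃x y : FreeAlgebra ℝ (A ⊕ Fin d)⦄ (h : WeylRel hD A hA x y) :
    freeAction hD A x = freeAction hD A y := by
  cases h with
  | add a b => ext f; simp [freeAction, mulOp, add_mul]
  | mul a b => ext f; simp [freeAction, mulOp]
  | scalar c => ext f; simp [freeAction, mulOp]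
  | comm i j => simp [freeAction, partialOp_comm hD i j]
  | leibniz i a =>
    refine LinearMap.ext fun f => ?_
    simp [freeAction, mulOp, partialOp_mul]

/-- The action of the Weyl algebra on `C^∞(D, ℝ)`. -/
noncomputable def weylAction {D : Set (Eucl d)} (hD : D ⊆ closure (interior D))
    (A : Subalgebra ℝ (SmoothFun D)) (hA : ∀ i, ∀ a ∈ A, partialOp hD i a ∈ A) :
    WeylAlg hD A hA →ₐ[ℝ] Module.End ℝ (SmoothFun D) :=
  RingQuot.liftAlgHom ℝ ⟨freeAction hD A, freeAction_rel hD A hA⟩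

/-- `B`, an `l × m` matrix of operators on `C^∞(D, ℝ)`, is a linear operator over one of the three
operator rings: `ℝ[∂_1, …, ∂_d]`, or `ℝ[f_1, …, f_n]` acting by multiplication for some
`f_1, …, f_n` in `C^∞(D, ℝ)`, or a Weyl algebra `ℝ[A]⟨∂_1, …, ∂_d⟩`. -/
def IsRingOperator {D : Set (Eucl d)} (hD : D ⊆ closure (interior D)) {l m : ℕ}
    (B : Matrix (Fin l) (Fin m) (Module.End ℝ (SmoothFun D))) : Prop :=
  (∃ P : Matrix (Fin l) (Fin m) (MvPolynomial (Fin d) ℝ), B = P.map (constCoeffOp hD)) ∨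
  (∃ (n : ℕ) (f : Fin n → SmoothFun D)
    (P : Matrix (Fin l) (Fin m) (Algebra.adjoin ℝ (Set.range f))),
    B = P.map (fun a => mulOp (a : SmoothFun D))) ∨
  (∃ (A : Subalgebra ℝ (SmoothFun D)) (hA : ∀ i, ∀ a ∈ A, partialOp hD i a ∈ A)
    (P : Matrix (Fin l) (Fin m) (WeylAlg hD A hA)), B = P.map (weylAction hD A hA))

open Classical in
/-- Application of an operator matrix `B : C^∞(D, ℝ)^m → C^∞(D, ℝ)^l` to a function
`v : D → ℝ^m`, namely `(B v)_i = ∑_j B_{ij} v_j`. The value is `0` if `v` is not smooth. -/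
noncomputable def applyOp {D : Set (Eucl d)} {l m : ℕ}
    (B : Matrix (Fin l) (Fin m) (Module.End ℝ (SmoothFun D))) (v : D → Fin m → ℝ) :
    D → Fin l → ℝ :=
  if h : ∀ j, (fun x => v x j) ∈ SmoothFun D then
    fun x i => ((∑ j, B i j ⟨fun y => v y j, h j⟩ : SmoothFun D) : D → ℝ) x
  else 0

end OperatorRings

section GaussianProcesses

/-- `g = GP(μ, k)`: the `ℝ^m`-valued process `g` on `D` is Gaussian under `P`, with mean
function `μ` and matrix-valued covariance function `k`. -/
structure IsGP {Ω : Type*} [MeasurableSpace Ω] (P : Measure Ω) {D : Set (Eucl d)} {m : ℕ}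
    (g : D → Ω → Fin m → ℝ) (μ : D → Fin m → ℝ) (k : D → D → Matrix (Fin m) (Fin m) ℝ) :
    Prop where
  gaussian : IsGaussianProcess g P
  mean : ∀ x i, ∫ w, g x w i ∂P = μ x i
  cov : ∀ x x' i j, ∫ w, (g x w i - μ x i) * (g x' w j - μ x' j) ∂P = k x x' i j

/-- The pushforward process `B_* g`, with realizations `B (g(·, w))`. -/
noncomputable def pushforward {Ω : Type*} {D : Set (Eucl d)} {l m : ℕ}
    (B : Matrix (Fin l) (Fin m) (Module.End ℝ (SmoothFun D))) (g : D → Ω → Fin m → ℝ) :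
    D → Ω → Fin l → ℝ :=
  fun x w => applyOp B (fun y => g y w) x

/-- The matrix function `B k(x, x')`, with `B` acting on the columns of `k` as functions of the
first argument `x`. -/
noncomputable def leftApply {D : Set (Eucl d)} {l m : ℕ}
    (B : Matrix (Fin l) (Fin m) (Module.End ℝ (SmoothFun D)))
    (k : D → D → Matrix (Fin m) (Fin m) ℝ) : D → D → Matrix (Fin l) (Fin m) ℝ :=
  fun x x' => Matrix.of fun i b => applyOp B (fun y a => k y x' a b) x i

/-- The matrix function `K(x, x') (B')ᵀ`, with `B` acting on the rows of `K` as functions of the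
second argument `x'`. -/
noncomputable def rightApply {D : Set (Eucl d)} {l m : ℕ}
    (B : Matrix (Fin l) (Fin m) (Module.End ℝ (SmoothFun D)))
    (K : D → D → Matrix (Fin l) (Fin m) ℝ) : D → D → Matrix (Fin l) (Fin l) ℝ :=
  fun x x' => Matrix.of fun i j => applyOp B (fun y b => K x y i b) x' j

end GaussianProcesses

end GPPush

namespace GPPush

/-! ### Gaussian variables in `L²`: almost sure limits are `L²` limits. -/

section GaussianL2

open Filter Topology

variable {Ω : Type*} [MeasurableSpace Ω] {P : Measure Ω} [IsProbabilityMeasure P]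

/-! Formally, the theorem says that `B` may be exchanged with expectations. No integrable bound on
the derivatives of the paths is given; the Gaussian law replaces it. If Gaussian variables tend to
`0` almost surely, their characteristic functions at `1`, of modulus `exp(-Var/2)`, tend to `1`.
Hence the variances tend to `0`, then the means, so the convergence holds in `L²`
(`tendsto_zero_of_ae`).

Let `H` be the closed span in `L²` of all components `g_j(x)`. Gaussian laws form a closed set in
`L²`, so all of `H` is Gaussian, and pathwise limits of elements of `H` stay in `H` and are `L²`
limits (`exists_mem_tendsto_of_ae`). Applied to difference quotients, and to limits from the
interior at the remaining points, this gives pathwise derivatives with values in `H`. Applied to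
increments and Fréchet remainders, it makes `x ↦ g_j(x)` continuous into `L²` and differentiable on
the interior, with the pathwise derivatives as partial derivatives (`IsField.hasFDerivAt`).

A continuous linear functional on `L²` therefore commutes with each `∂_i`, and trivially with
multiplications. The operators with this property form an algebra, which contains the entries of `B`
in all three cases (`isRingOperator_mem_fieldOps`). The functional `E` gives the mean of `B_* g`;
covariance with a fixed element of `H`, used once for each argument, gives its covariance. The
process is Gaussian because its components lie in `H`. -/

/-- The expectation as a continuous linear functional on `L²`. -/
noncomputable def expL2 (P : Measure Ω) [IsProbabilityMeasure P] : Lp ℝ 2 P →L[ℝ] ℝ :=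
  innerSL ℝ ((memLp_const (1 : ℝ)).toLp (fun _ : Ω => (1 : ℝ)))

lemma expL2_apply (u : Lp ℝ 2 P) : expL2 P u = ∫ w, u w ∂P := by
  rw [expL2, innerSL_apply_apply, L2.inner_def]
  exact integral_congr_ae (ae_of_all _ fun w => by simp)

/-- The covariance with `u` as a continuous linear functional on `L²`. -/
noncomputable def covL2 (u : Lp ℝ 2 P) : Lp ℝ 2 P →L[ℝ] ℝ :=
  innerSL ℝ u - expL2 P u • expL2 P

lemma covL2_apply (u v : Lp ℝ 2 P) :
    covL2 u v = ∫ w, (u w - expL2 P u) * (v w - expL2 P v) ∂P := by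
  have hu : Integrable u P := (Lp.memLp u).integrable (by norm_num)
  have hv : Integrable v P := (Lp.memLp v).integrable (by norm_num)
  have huv : Integrable (fun w => u w * v w) P := (Lp.memLp u).integrable_mul (Lp.memLp v)
  have e : ∀ w, (u w - expL2 P u) * (v w - expL2 P v) =
      u w * v w - expL2 P v * u w - expL2 P u * v w + expL2 P u * expL2 P v := fun w => by ring
  simp only [e]
  rw [integral_add (by fun_prop) (by fun_prop), integral_sub (by fun_prop) (by fun_prop),
    integral_sub (by fun_prop) (by fun_prop), integral_const_mul, integral_const_mul,
    ← expL2_apply, ← expL2_apply]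
  have : inner ℝ u v = ∫ w, u w * v w ∂P := by
    rw [L2.inner_def]
    exact integral_congr_ae (ae_of_all _ fun w => by simp [mul_comm])
  simp [covL2, this]
  ring

lemma covL2_comm (u v : Lp ℝ 2 P) : covL2 u v = covL2 v u := by
  simp only [covL2_apply, mul_comm]

lemma variance_eq_covL2 (u : Lp ℝ 2 P) : Var[u; P] = covL2 u u := by
  rw [covL2_apply, variance_eq_integral (Lp.aestronglyMeasurable u).aemeasurable, expL2_apply]
  simp [sq]

lemma norm_sq_eq_covL2 (u : Lp ℝ 2 P) : ‖u‖ ^ 2 = covL2 u u + expL2 P u ^ 2 := by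
  simp [covL2, sq]

/-- This is nonnegativity of the variance of `|f|`. -/
lemma integral_abs_le_sqrt {f : Ω → ℝ} (hf : MemLp f 2 P) :
    ∫ w, |f w| ∂P ≤ √(∫ w, f w ^ 2 ∂P) := by
  refine Real.le_sqrt_of_sq_le ?_
  have h := variance_nonneg |f| P
  rw [variance_eq_sub hf.abs] at h
  simpa using h

lemma integral_abs_le_norm (u : Lp ℝ 2 P) : ∫ w, |u w| ∂P ≤ ‖u‖ := by
  refine (integral_abs_le_sqrt (Lp.memLp u)).trans (le_of_eq ?_)
  rw [← Real.sqrt_sq (norm_nonneg u), ← real_inner_self_eq_norm_sq, L2.inner_def]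
  simp [sq]

/-- The map is 1-Lipschitz: `|e^{ia} - e^{ib}| ≤ |a - b|`, and the `L¹` norm is at most the `L²`
norm on a probability space. -/
lemma continuous_integral_exp :
    Continuous fun u : Lp ℝ 2 P => ∫ w, Complex.exp (u w * Complex.I) ∂P := by
  refine (LipschitzWith.of_dist_le_mul (K := 1) fun u v => ?_).continuous
  have hi : ∀ u : Lp ℝ 2 P, Integrable (fun w => Complex.exp (u w * Complex.I)) P := fun u => by
    refine Integrable.of_bound (C := 1) ?_ (ae_of_all _ fun w => ?_)
    · exact Complex.continuous_exp.comp_aestronglyMeasurable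
        ((Complex.continuous_ofReal.comp_aestronglyMeasurable
          (Lp.aestronglyMeasurable u)).mul_const _)
    · rw [Complex.norm_exp_ofReal_mul_I]
  rw [dist_eq_norm, ← integral_sub (hi u) (hi v), dist_eq_norm, NNReal.coe_one, one_mul]
  refine (norm_integral_le_integral_norm _).trans (le_trans ?_ (integral_abs_le_norm (u - v)))
  refine integral_mono_ae ((hi u).sub (hi v)).norm
    ((Lp.memLp (u - v)).integrable (by norm_num)).abs ?_
  filter_upwards [Lp.coeFn_sub u v] with w hw
  rw [hw, Pi.sub_apply]
  have e : Complex.exp (u w * Complex.I) - Complex.exp (v w * Complex.I) =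
      Complex.exp (v w * Complex.I) * (Complex.exp (Complex.I * ((u w - v w : ℝ) : ℂ)) - 1) := by
    rw [mul_sub, ← Complex.exp_add, mul_one]
    congr 2
    push_cast
    ring
  rw [e, norm_mul, Complex.norm_exp_ofReal_mul_I, one_mul]
  exact Real.norm_exp_I_mul_ofReal_sub_one_le

/-- The usual characteristic function criterion, with `t` absorbed into the variable so that both
sides are visibly continuous in `u` for the `L²` norm. -/
lemma hasGaussianLaw_iff_integral_exp (u : Lp ℝ 2 P) : HasGaussianLaw u P ↔ ∀ t : ℝ,
    ∫ w, Complex.exp ((t • u : Lp ℝ 2 P) w * Complex.I) ∂P =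
      Complex.exp (expL2 P (t • u) * Complex.I - covL2 (t • u) (t • u) / 2) := by
  have hm := (Lp.aestronglyMeasurable u).aemeasurable
  rw [hasGaussianLaw_iff_charFun_map_eq hm]
  refine forall_congr' fun t => ?_
  have h1 : (fun w => inner ℝ t (u w)) =ᵐ[P] (t • u : Lp ℝ 2 P) := by
    filter_upwards [Lp.coeFn_smul t u] with w hw
    rw [hw]
    simp [mul_comm]
  beta_reduce
  rw [variance_congr h1, integral_congr_ae h1, variance_eq_covL2, ← expL2_apply, charFun_apply,
    integral_map hm (by fun_prop)]
  refine Eq.congr_left (integral_congr_ae ?_)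
  filter_upwards [h1] with w hw
  rw [← hw, real_inner_comm]

lemma continuous_covL2_self : Continuous fun u : Lp ℝ 2 P => covL2 u u := by
  simp only [covL2, sub_apply, innerSL_apply_apply,
    smul_apply]
  fun_prop

lemma isClosed_hasGaussianLaw : IsClosed {u : Lp ℝ 2 P | HasGaussianLaw u P} := by
  simp only [hasGaussianLaw_iff_integral_exp, ofPred_forall]
  refine isClosed_iInter fun t => isClosed_eq ?_ ?_
  · exact continuous_integral_exp.comp (continuous_const_smul t)
  · have := (continuous_covL2_self (P := P)).comp (continuous_const_smul t)
    refine Complex.continuous_exp.comp (.sub ?_ (.div_const ?_ _))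
    · fun_prop
    · exact Complex.continuous_ofReal.comp this

/-- The variance is controlled by the characteristic function and the mean by a truncated first
moment. Both involve bounded integrands, so dominated convergence applies without any moment bound.
-/
lemma tendsto_zero_of_ae {ι : Type*} {l : Filter ι} [l.IsCountablyGenerated]
    {V : ι → Lp ℝ 2 P} (hV : ∀ᶠ i in l, HasGaussianLaw (V i) P) {v : ι → Ω → ℝ}
    (hv : ∀ᶠ i in l, v i =ᵐ[P] V i)
    (h : ∀ᵐ w ∂P, Tendsto (fun i => v i w) l (𝓝 0)) : Tendsto V l (𝓝 0) := by
  have hvm : ∀ᶠ i in l, AEStronglyMeasurable (v i) P := by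
    filter_upwards [hv] with i hi using (Lp.aestronglyMeasurable (V i)).congr hi.symm
  -- the characteristic function at `1`
  have h1 : Tendsto (fun i => ∫ w, Complex.exp (V i w * Complex.I) ∂P) l (𝓝 1) := by
    have : Tendsto (fun i => ∫ w, Complex.exp (v i w * Complex.I) ∂P) l
        (𝓝 (∫ w, 1 ∂P)) := by
      refine tendsto_integral_filter_of_dominated_convergence (fun _ => 1) ?_ ?_
        (integrable_const _) ?_
      · filter_upwards [hvm] with i hi
        exact Complex.continuous_exp.comp_aestronglyMeasurable
          ((Complex.continuous_ofReal.comp_aestronglyMeasurable hi).mul_const _)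
      · exact Eventually.of_forall fun i => ae_of_all _ fun w => by
          rw [Complex.norm_exp_ofReal_mul_I]
      · filter_upwards [h] with w hw
        have : Continuous fun x : ℝ => Complex.exp (x * Complex.I) := by fun_prop
        simpa [Function.comp_def] using (this.tendsto 0).comp hw
    simp only [integral_const, probReal_univ, one_smul] at this
    refine this.congr' ?_
    filter_upwards [hv] with i hi
    refine integral_congr_ae ?_
    filter_upwards [hi] with w hw
    rw [hw]
  have hvar : Tendsto (fun i => covL2 (V i) (V i)) l (𝓝 0) := by
    -- Taking the modulus removes the unknown mean from the Gaussian characteristic function.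
    have h2 : Tendsto (fun i => Real.exp (-(covL2 (V i) (V i)) / 2)) l (𝓝 1) := by
      refine (by simpa using h1.norm : Tendsto _ l (𝓝 (1 : ℝ))).congr' ?_
      filter_upwards [hV] with i hi
      have := (hasGaussianLaw_iff_integral_exp (V i)).1 hi 1
      rw [one_smul] at this
      rw [this, Complex.norm_exp]
      simp [neg_div]
    have h3 := (h2.log one_ne_zero).const_mul (-2)
    simp only [Real.log_exp, Real.log_one, mul_zero] at h3
    exact h3.congr fun i => by ring
  have hmean : Tendsto (fun i => expL2 P (V i)) l (𝓝 0) := by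
    have h2 : Tendsto (fun i => ∫ w, min |v i w| 1 ∂P) l (𝓝 (∫ w, 0 ∂P)) := by
      refine tendsto_integral_filter_of_dominated_convergence (fun _ => 1) ?_ ?_
        (integrable_const _) ?_
      · filter_upwards [hvm] with i hi
        have : Continuous fun x : ℝ => min |x| 1 := by fun_prop
        exact this.comp_aestronglyMeasurable hi
      · exact Eventually.of_forall fun i => ae_of_all _ fun w => by
          rw [Real.norm_of_nonneg (by positivity)]
          exact min_le_right _ _
      · filter_upwards [h] with w hw
        have : Continuous fun x : ℝ => min |x| 1 := by fun_prop
        simpa [Function.comp_def] using (this.tendsto 0).comp hw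
    rw [integral_zero] at h2
    -- `min(|E V|, 1) ≤ min(|V|, 1) + |V - E V|` pointwise, and the last term has integral at most
    -- the standard deviation.
    have h3 : Tendsto (fun i => min |expL2 P (V i)| 1) l (𝓝 0) := by
      have h4 : Tendsto (fun i => (∫ w, min |v i w| 1 ∂P) + √(covL2 (V i) (V i))) l (𝓝 0) := by
        simpa using h2.add hvar.sqrt
      refine tendsto_of_tendsto_of_tendsto_of_le_of_le' tendsto_const_nhds h4
        (Eventually.of_forall fun i => by positivity) ?_
      filter_upwards [hv] with i hi
      have hi' : MemLp (fun w => V i w - expL2 P (V i)) 2 P :=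
        (Lp.memLp (V i)).sub (memLp_const _)
      have hmin : Integrable (fun w => min |v i w| 1) P := by
        refine Integrable.of_bound (C := 1) ?_ (ae_of_all _ fun w => ?_)
        · have : Continuous fun x : ℝ => min |x| 1 := by fun_prop
          exact this.comp_aestronglyMeasurable
            ((Lp.aestronglyMeasurable (V i)).congr hi.symm)
        · rw [Real.norm_of_nonneg (by positivity)]
          exact min_le_right _ _
      have h5 := integral_abs_le_sqrt hi'
      simp only [sq, ← covL2_apply] at h5
      refine le_trans ?_ (add_le_add_right h5 _)
      rw [← integral_add hmin (hi'.integrable (by norm_num)).abs]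
      calc min |expL2 P (V i)| 1 = ∫ _, min |expL2 P (V i)| 1 ∂P := by simp
        _ ≤ _ := by
          refine integral_mono_ae (integrable_const _)
            (hmin.add (hi'.integrable (by norm_num)).abs) ?_
          filter_upwards [hi] with w hw
          simp only [hw]
          have h6 := abs_sub_abs_le_abs_sub (expL2 P (V i)) (V i w)
          rw [abs_sub_comm] at h6
          rcases le_total |V i w| 1 with h | h
          · rw [min_eq_left h]
            exact (min_le_left _ _).trans (by linarith)
          · rw [min_eq_right h]
            exact (min_le_right _ _).trans (by linarith [abs_nonneg (V i w - expL2 P (V i))])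
    -- Once the minimum is below `1`, the truncation is inactive.
    rw [tendsto_zero_iff_abs_tendsto_zero]
    refine h3.congr' ?_
    filter_upwards [h3.eventually (gt_mem_nhds one_pos)] with i hi
    rcases min_lt_iff.1 hi with h' | h'
    · exact min_eq_left h'.le
    · exact absurd h' (lt_irrefl _)
  rw [tendsto_zero_iff_norm_tendsto_zero]
  have := (hvar.add (hmean.pow 2)).sqrt
  simpa [← norm_sq_eq_covL2] using this

/-- An almost sure limit of elements of a closed Gaussian subspace of `L²` belongs to the subspace,
and is a limit in `L²`. -/
lemma exists_mem_tendsto_of_ae {H : Submodule ℝ (Lp ℝ 2 P)} (hc : IsClosed (H : Set (Lp ℝ 2 P)))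
    (hH : ∀ u ∈ H, HasGaussianLaw u P) {ι : Type*} {l : Filter ι} [l.NeBot]
    [l.IsCountablyGenerated] {V : ι → Lp ℝ 2 P} (hV : ∀ᶠ i in l, V i ∈ H) {v : ι → Ω → ℝ}
    (hv : ∀ᶠ i in l, v i =ᵐ[P] V i) {Y : Ω → ℝ}
    (h : ∀ᵐ w ∂P, Tendsto (fun i => v i w) l (𝓝 (Y w))) :
    ∃ u ∈ H, Y =ᵐ[P] u ∧ Tendsto V l (𝓝 u) := by
  -- The limit `Y` is not yet known to be Gaussian, so the criterion is applied to the differences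
  -- `V j - V i` along `l ×ˢ l`.
  have hcauchy : Cauchy (map V l) := by
    rw [cauchy_map_iff, uniformity_eq_comap_nhds_zero, tendsto_comap_iff]
    refine ⟨inferInstance, ?_⟩
    refine tendsto_zero_of_ae (v := fun p w => v p.2 w - v p.1 w) ?_ ?_ ?_
    · filter_upwards [hV.prod_mk hV] with p hp using hH _ (H.sub_mem hp.2 hp.1)
    · filter_upwards [hv.prod_mk hv] with p hp
      exact (hp.2.sub hp.1).trans (Lp.coeFn_sub _ _).symm
    · filter_upwards [h] with w hw
      simpa using (hw.comp tendsto_snd).sub (hw.comp tendsto_fst)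
  obtain ⟨u, hu⟩ := CompleteSpace.complete hcauchy
  have hu' : Tendsto V l (𝓝 u) := hu
  refine ⟨u, hc.mem_of_tendsto hu' hV, ?_, hu'⟩
  -- An almost surely convergent subsequence identifies the `L²` limit with `Y`; being countable, it
  -- needs only one null set for all the equalities `v = V`.
  obtain ⟨ns, hns, hlim⟩ := (tendstoInMeasure_of_tendsto_Lp hu').exists_seq_tendsto_ae'
  obtain ⟨N, hN⟩ := eventually_atTop.1 (hns.eventually hv)
  have hall : ∀ᵐ w ∂P, ∀ n, N ≤ n → v (ns n) w = V (ns n) w :=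
    ae_all_iff.2 fun n => by
      by_cases hn : N ≤ n
      · filter_upwards [hN n hn] with w hw _ using hw
      · exact ae_of_all _ fun w h => absurd h hn
  filter_upwards [h, hlim, hall] with w h1 h2 h3
  refine tendsto_nhds_unique ((h1.comp hns).congr' ?_) h2
  filter_upwards [eventually_ge_atTop N] with n hn using h3 n hn

end GaussianL2
-- Smoothness from families closed under differentiation.
section Families

variable {d : ℕ} {D : Set (Eucl d)}

/-- A family of continuous functions on `D` that are differentiable on the interior, with all
partial derivatives in the family, consists of smooth functions. -/
lemma isSmooth_of_family (S : Set (D → ℝ)) (hcont : ∀ f ∈ S, Continuous f)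
    (hder : ∀ f ∈ S, ∃ f' : Fin d → D → ℝ, (∀ i, f' i ∈ S) ∧ ∀ x ∈ interior D,
      HasFDerivAt (zeroExt D f)
        (∑ i, zeroExt D (f' i) x • (EuclideanSpace.proj i : Eucl d →L[ℝ] ℝ)) x)
    {f : D → ℝ} (hf : f ∈ S) : IsSmooth D f := by
  refine ⟨hcont f hf, contDiffOn_infty.2 fun n => ?_, fun L => ?_⟩
  · induction n generalizing f with
    | zero =>
      refine contDiffOn_zero.2 fun x hx => ?_
      obtain ⟨f', -, h⟩ := hder f hf
      exact (h x hx).continuousAt.continuousWithinAt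
    | succ n ih =>
      obtain ⟨f', hf', h⟩ := hder f hf
      push_cast
      refine (contDiffOn_succ_iff_fderiv_of_isOpen isOpen_interior).2
        ⟨fun x hx => (h x hx).differentiableAt.differentiableWithinAt, by simp, ?_⟩
      refine ContDiffOn.congr (f := fun x => ∑ i, zeroExt D (f' i) x •
        (EuclideanSpace.proj i : Eucl d →L[ℝ] ℝ)) ?_ fun x hx => (h x hx).fderiv
      exact ContDiffOn.sum fun i _ => (ih (hf' i)).smul contDiffOn_const
  · induction L generalizing f with
    | nil => exact ⟨f, hcont f hf, fun x _ => (zeroExt_apply f x).symm⟩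
    | cons i L ih =>
      obtain ⟨f', hf', h⟩ := hder f hf
      obtain ⟨a, ha, ha'⟩ := ih (hf' i)
      refine ⟨a, ha, fun x hx => ?_⟩
      rw [ha' x hx]
      refine iterPDeriv_congr isOpen_interior L (fun y hy => ?_) hx
      simp [pderiv, (h y hy).fderiv]

lemma smoothFun_hasFDerivAt (hD : D ⊆ closure (interior D)) (f : SmoothFun D) {x : Eucl d}
    (hx : x ∈ interior D) :
    HasFDerivAt (zeroExt D f)
      (∑ i, zeroExt D (partialOp hD i f) x • (EuclideanSpace.proj i : Eucl d →L[ℝ] ℝ)) x := by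
  have h := (differentiableAt_of isOpen_interior f.2.contDiffOn hx).hasFDerivAt
  convert! h using 1
  ext v
  have hv : v = ∑ i, v i • (EuclideanSpace.single i (1 : ℝ) : Eucl d) := by
    ext j
    simp [Pi.single_apply]
  conv_rhs => rw [hv]
  simp [partialOp_eqOn hD _ f hx, pderiv, mul_comm]

end Families

/-! ### Random smooth functions as `L²`-valued maps, and operators acting on them. -/

section Fields

open Filter Topology

variable {d : ℕ} {D : Set (Eucl d)} {Ω : Type*} [MeasurableSpace Ω] {P : Measure Ω}

/-- `U` is the `L²`-valued version of the random smooth function `h`, with values in the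
subspace `H`. -/
structure IsField (H : Submodule ℝ (Lp ℝ 2 P)) (h : Ω → SmoothFun D) (U : D → Lp ℝ 2 P) :
    Prop where
  mem : ∀ x, U x ∈ H
  ae_eq : ∀ x, (fun w => (h w : D → ℝ) x) =ᵐ[P] U x

lemma ae_eq_add {f g : Ω → ℝ} {u v : Lp ℝ 2 P} (hf : f =ᵐ[P] u) (hg : g =ᵐ[P] v) :
    (fun w => f w + g w) =ᵐ[P] (u + v : Lp ℝ 2 P) :=
  (hf.add hg).trans (Lp.coeFn_add u v).symm

lemma ae_eq_sub {f g : Ω → ℝ} {u v : Lp ℝ 2 P} (hf : f =ᵐ[P] u) (hg : g =ᵐ[P] v) :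
    (fun w => f w - g w) =ᵐ[P] (u - v : Lp ℝ 2 P) :=
  (hf.sub hg).trans (Lp.coeFn_sub u v).symm

lemma ae_eq_smul (c : ℝ) {f : Ω → ℝ} {u : Lp ℝ 2 P} (hf : f =ᵐ[P] u) :
    (fun w => c * f w) =ᵐ[P] (c • u : Lp ℝ 2 P) :=
  (hf.const_smul c).trans (Lp.coeFn_smul c u).symm

lemma ae_eq_sum {ι : Type*} (s : Finset ι) {f : ι → Ω → ℝ} {u : ι → Lp ℝ 2 P}
    (h : ∀ i, f i =ᵐ[P] u i) :
    (fun w => ∑ i ∈ s, f i w) =ᵐ[P] (∑ i ∈ s, u i : Lp ℝ 2 P) := by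
  classical
  induction s using Finset.induction_on with
  | empty => exact (Lp.coeFn_zero ℝ 2 P).symm
  | insert i s hi ih =>
    simp only [Finset.sum_insert hi]
    exact ae_eq_add (h i) ih

variable {H : Submodule ℝ (Lp ℝ 2 P)} {h : Ω → SmoothFun D}
  {U : D → Lp ℝ 2 P}

/-- The extension by zero of an `L²`-valued function on `D`. -/
noncomputable def lpExt (U : D → Lp ℝ 2 P) : Eucl d → Lp ℝ 2 P :=
  Function.extend Subtype.val U 0

lemma lpExt_apply (U : D → Lp ℝ 2 P) (x : D) : lpExt U x = U x :=
  Subtype.val_injective.extend_apply U 0 x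

lemma IsField.lpExt_mem (hU : IsField H h U) {x : Eucl d} (hx : x ∈ D) : lpExt U x ∈ H := by
  lift x to D using hx
  rw [lpExt_apply]
  exact hU.mem x

lemma IsField.lpExt_ae_eq (hU : IsField H h U) {x : Eucl d} (hx : x ∈ D) :
    (fun w => zeroExt D (h w) x) =ᵐ[P] lpExt U x := by
  lift x to D using hx
  simp only [zeroExt_apply, lpExt_apply]
  exact hU.ae_eq x

lemma zeroExt_comp_lp (φ : Lp ℝ 2 P →L[ℝ] ℝ) (U : D → Lp ℝ 2 P) :
    zeroExt D (fun x => φ (U x)) = fun x => φ (lpExt U x) := by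
  ext x
  by_cases hx : x ∈ D
  · lift x to D using hx
    rw [zeroExt_apply, lpExt_apply]
  · rw [zeroExt, lpExt, Function.extend_apply', Function.extend_apply']
    · simp
    all_goals
      rintro ⟨y, rfl⟩
      exact hx y.2

/-- The operators on `C^∞(D, ℝ)` that preserve the fields with values in `H` and commute with
continuous linear functionals on them. -/
def fieldOps (D : Set (Eucl d)) (H : Submodule ℝ (Lp ℝ 2 P)) :
    Set (Module.End ℝ (SmoothFun D)) :=
  {T | ∀ (h : Ω → SmoothFun D) (U : D → Lp ℝ 2 P), IsField H h U →
    ∃ U', IsField H (fun w => T (h w)) U' ∧ ∀ (φ : Lp ℝ 2 P →L[ℝ] ℝ)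
      (hφ : (fun x => φ (U x)) ∈ SmoothFun D), ∀ x,
      (T ⟨_, hφ⟩ : D → ℝ) x = φ (U' x)}

lemma mulOp_mem_fieldOps (f : SmoothFun D) : mulOp f ∈ fieldOps D H := by
  intro h U hU
  refine ⟨fun x => (f : D → ℝ) x • U x, ⟨fun x => H.smul_mem _ (hU.mem x),
    fun x => ae_eq_smul _ (hU.ae_eq x)⟩, fun φ hφ x => ?_⟩
  simp [mulOp]

variable [IsProbabilityMeasure P]

lemma IsField.continuous (hH : ∀ u ∈ H, HasGaussianLaw u P) (hU : IsField H h U) :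
    Continuous U := by
  refine continuous_iff_continuousAt.2 fun x => tendsto_sub_nhds_zero_iff.1 ?_
  refine tendsto_zero_of_ae (v := fun y w => (h w : D → ℝ) y - (h w : D → ℝ) x)
    (.of_forall fun y => hH _ (H.sub_mem (hU.mem y) (hU.mem x)))
    (.of_forall fun y => ae_eq_sub (hU.ae_eq y) (hU.ae_eq x)) (ae_of_all _ fun w => ?_)
  exact tendsto_sub_nhds_zero_iff.2 ((h w).2.continuous.tendsto x)

/-- The difference quotients lie in `H` and converge along every path, so their limit lies in `H`.
-/
lemma IsField.exists_partialOp_of_mem_interior (hD : D ⊆ closure (interior D))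
    (hc : IsClosed (H : Set (Lp ℝ 2 P))) (hH : ∀ u ∈ H, HasGaussianLaw u P)
    (hU : IsField H h U) (i : Fin d) (x : D) (hx : (x : Eucl d) ∈ interior D) :
    ∃ u ∈ H, (fun w => (partialOp hD i (h w) : D → ℝ) x) =ᵐ[P] u := by
  let c : ℝ → Eucl d := fun t => x + t • EuclideanSpace.single i (1 : ℝ)
  have hcc : Continuous c := by fun_prop
  have hint : ∀ᶠ t in 𝓝[≠] (0 : ℝ), c t ∈ D := by
    refine nhdsWithin_le_nhds (hcc.tendsto 0 ?_)
    simpa [c] using mem_interior_iff_mem_nhds.1 hx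
  obtain ⟨u, hu, hu', -⟩ := exists_mem_tendsto_of_ae hc hH (l := 𝓝[≠] (0 : ℝ))
    (V := fun t => t⁻¹ • (lpExt U (c t) - lpExt U x))
    (v := fun t w => t⁻¹ * (zeroExt D (h w) (c t) - zeroExt D (h w) x))
    (Y := fun w => (partialOp hD i (h w) : D → ℝ) x)
    (by filter_upwards [hint] with t ht using
      H.smul_mem _ (H.sub_mem (hU.lpExt_mem ht) (hU.lpExt_mem x.2)))
    (by filter_upwards [hint] with t ht using
      ae_eq_smul _ (ae_eq_sub (hU.lpExt_ae_eq ht) (hU.lpExt_ae_eq x.2)))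
    (ae_of_all _ fun w => by
      have h1 := (smoothFun_hasFDerivAt hD (h w) hx).hasLineDerivAt (EuclideanSpace.single i 1)
      have h2 := (hasLineDerivAt_iff_tendsto_slope_zero).1 h1
      simpa [Pi.single_apply, zeroExt_apply] using h2)
  exact ⟨u, hu, hu'⟩

/-- At a point outside the interior, the pathwise derivative is the limit of its values at interior
points, which are already in `H`. -/
lemma IsField.exists_partialOp (hD : D ⊆ closure (interior D))
    (hc : IsClosed (H : Set (Lp ℝ 2 P))) (hH : ∀ u ∈ H, HasGaussianLaw u P)
    (hU : IsField H h U) (i : Fin d) :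
    ∃ U', IsField H (fun w => partialOp hD i (h w)) U' := by
  have key : ∀ x : D, ∃ u ∈ H, (fun w => (partialOp hD i (h w) : D → ℝ) x) =ᵐ[P] u := by
    intro x
    -- `V` is arbitrary off the interior; the filter `l` below sees only interior points.
    choose! V hV hV' using hU.exists_partialOp_of_mem_interior hD hc hH i
    let l : Filter D := comap Subtype.val (𝓝[interior D] (x : Eucl d))
    have hl : l ≤ 𝓝 x := by
      rw [nhds_subtype]
      exact comap_mono nhdsWithin_le_nhds
    have hint : ∀ᶠ y : D in l, (y : Eucl d) ∈ interior D :=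
      tendsto_comap.eventually self_mem_nhdsWithin
    have : (𝓝[interior D] (x : Eucl d)).NeBot := mem_closure_iff_nhdsWithin_neBot.1 (hD x.2)
    have : l.NeBot := by
      refine NeBot.comap_of_range_mem this ?_
      rw [Subtype.range_coe]
      exact mem_of_superset self_mem_nhdsWithin interior_subset
    obtain ⟨u, hu, hu', -⟩ := exists_mem_tendsto_of_ae hc hH (l := l) (V := V)
      (v := fun y w => (partialOp hD i (h w) : D → ℝ) y)
      (Y := fun w => (partialOp hD i (h w) : D → ℝ) x)
      (hint.mono fun y hy => hV y hy) (hint.mono fun y hy => hV' y hy)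
      (ae_of_all _ fun w => ((partialOp hD i (h w)).2.continuous.tendsto x).mono_left hl)
    exact ⟨u, hu, hu'⟩
  choose U' h1 h2 using key
  exact ⟨U', h1, h2⟩

/-- The normalized first-order remainder lies in `H` near `x` and tends to `0` along every path,
hence in `L²`. -/
lemma IsField.hasFDerivAt (hD : D ⊆ closure (interior D))
    (hH : ∀ u ∈ H, HasGaussianLaw u P) (hU : IsField H h U) {U' : Fin d → D → Lp ℝ 2 P}
    (hU' : ∀ i, IsField H (fun w => partialOp hD i (h w)) (U' i)) {x : Eucl d}
    (hx : x ∈ interior D) :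
    HasFDerivAt (lpExt U) (∑ i, (EuclideanSpace.proj i : Eucl d →L[ℝ] ℝ).smulRight
      (lpExt (U' i) x)) x := by
  have hxD := interior_subset hx
  have hint : ∀ᶠ y in 𝓝 x, y ∈ D := mem_interior_iff_mem_nhds.1 hx
  have key : Tendsto (fun y => ‖y - x‖⁻¹ •
      (lpExt U y - lpExt U x - ∑ i, (y - x) i • lpExt (U' i) x)) (𝓝 x) (𝓝 0) := by
    refine tendsto_zero_of_ae (v := fun y w => ‖y - x‖⁻¹ *
      (zeroExt D (h w) y - zeroExt D (h w) x -
        ∑ i, (y - x) i * zeroExt D (partialOp hD i (h w)) x)) ?_ ?_ ?_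
    · filter_upwards [hint] with y hy
      exact hH _ (H.smul_mem _ (H.sub_mem (H.sub_mem (hU.lpExt_mem hy) (hU.lpExt_mem hxD))
        (H.sum_mem fun i _ => H.smul_mem _ ((hU' i).lpExt_mem hxD))))
    · filter_upwards [hint] with y hy
      exact ae_eq_smul _ (ae_eq_sub (ae_eq_sub (hU.lpExt_ae_eq hy) (hU.lpExt_ae_eq hxD))
        (ae_eq_sum _ fun i => ae_eq_smul _ ((hU' i).lpExt_ae_eq hxD)))
    · refine ae_of_all _ fun w => ?_
      have h1 := hasFDerivAt_iff_tendsto.1 (smoothFun_hasFDerivAt hD (h w) hx)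
      rw [tendsto_zero_iff_norm_tendsto_zero]
      refine h1.congr fun y => ?_
      simp [mul_comm]
  rw [hasFDerivAt_iff_tendsto]
  refine (tendsto_zero_iff_norm_tendsto_zero.1 key).congr fun y => ?_
  simp [norm_smul]

lemma IsField.hasFDerivAt_clm (hD : D ⊆ closure (interior D))
    (hH : ∀ u ∈ H, HasGaussianLaw u P) (hU : IsField H h U) {U' : Fin d → D → Lp ℝ 2 P}
    (hU' : ∀ i, IsField H (fun w => partialOp hD i (h w)) (U' i)) (φ : Lp ℝ 2 P →L[ℝ] ℝ)
    {x : Eucl d} (hx : x ∈ interior D) :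
    HasFDerivAt (zeroExt D fun x => φ (U x))
      (∑ i, zeroExt D (fun x => φ (U' i x)) x • (EuclideanSpace.proj i : Eucl d →L[ℝ] ℝ)) x := by
  simp only [zeroExt_comp_lp]
  convert! φ.hasFDerivAt.comp x (hU.hasFDerivAt hD hH hU' hx) using 1
  ext v
  simp [mul_comm]

/-- For varying fields these functions form a family closed under partial derivatives, since the
derivative of a field is again a field. -/
lemma IsField.mem_smoothFun (hD : D ⊆ closure (interior D))
    (hc : IsClosed (H : Set (Lp ℝ 2 P))) (hH : ∀ u ∈ H, HasGaussianLaw u P)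
    (hU : IsField H h U) (φ : Lp ℝ 2 P →L[ℝ] ℝ) : (fun x => φ (U x)) ∈ SmoothFun D := by
  refine isSmooth_of_family {f | ∃ (h : Ω → SmoothFun D) (U : D → Lp ℝ 2 P),
    IsField H h U ∧ f = fun x => φ (U x)} ?_ ?_ ⟨h, U, hU, rfl⟩
  · rintro _ ⟨h, U, hU, rfl⟩
    exact φ.continuous.comp (hU.continuous hH)
  · rintro _ ⟨h, U, hU, rfl⟩
    choose U' hU' using hU.exists_partialOp hD hc hH
    exact ⟨fun i x => φ (U' i x), fun i => ⟨_, _, hU' i, rfl⟩,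
      fun x hx => hU.hasFDerivAt_clm hD hH hU' φ hx⟩

lemma partialOp_mem_fieldOps (hD : D ⊆ closure (interior D))
    (hc : IsClosed (H : Set (Lp ℝ 2 P))) (hH : ∀ u ∈ H, HasGaussianLaw u P) (i : Fin d) :
    partialOp hD i ∈ fieldOps D H := by
  intro h U hU
  choose U' hU' using hU.exists_partialOp hD hc hH
  refine ⟨U' i, hU' i, fun φ hφ => ?_⟩
  have hφ' := (hU' i).mem_smoothFun hD hc hH φ
  suffices partialOp hD i ⟨_, hφ⟩ = ⟨_, hφ'⟩ from fun x => congrFun (congrArg Subtype.val this) x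
  refine SmoothFun.ext_interior hD fun x hx => ?_
  rw [partialOp_eqOn hD i _ hx, pderiv, (hU.hasFDerivAt_clm hD hH hU' φ hx).fderiv]
  simp

variable (D H) in
/-- The operators `fieldOps` form an algebra. -/
def fieldOpsAlg (hD : D ⊆ closure (interior D)) (hc : IsClosed (H : Set (Lp ℝ 2 P)))
    (hH : ∀ u ∈ H, HasGaussianLaw u P) : Subalgebra ℝ (Module.End ℝ (SmoothFun D)) where
  carrier := fieldOps D H
  add_mem' {S T} hS hT h U hU := by
    obtain ⟨U₁, h₁, e₁⟩ := hS h U hU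
    obtain ⟨U₂, h₂, e₂⟩ := hT h U hU
    refine ⟨U₁ + U₂, ⟨fun x => H.add_mem (h₁.mem x) (h₂.mem x),
      fun x => ae_eq_add (h₁.ae_eq x) (h₂.ae_eq x)⟩, fun φ hφ x => ?_⟩
    simp [e₁ φ hφ x, e₂ φ hφ x]
  mul_mem' {S T} hS hT h U hU := by
    obtain ⟨U₁, h₁, e₁⟩ := hT h U hU
    obtain ⟨U₂, h₂, e₂⟩ := hS _ U₁ h₁
    refine ⟨U₂, h₂, fun φ hφ x => ?_⟩
    -- Composition needs `φ` of the intermediate field to be smooth, so that `S` can be applied to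
    -- it.
    have hφ' := h₁.mem_smoothFun hD hc hH φ
    have : T ⟨_, hφ⟩ = ⟨_, hφ'⟩ := Subtype.ext (funext (e₁ φ hφ))
    rw [Module.End.mul_apply, this, e₂ φ hφ' x]
  algebraMap_mem' c h U hU := by
    refine ⟨fun x => c • U x, ⟨fun x => H.smul_mem _ (hU.mem x),
      fun x => ae_eq_smul _ (hU.ae_eq x)⟩, fun φ hφ x => ?_⟩
    simp

lemma isRingOperator_mem_fieldOps (hD : D ⊆ closure (interior D))
    (hc : IsClosed (H : Set (Lp ℝ 2 P))) (hH : ∀ u ∈ H, HasGaussianLaw u P) {l m : ℕ}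
    {B : Matrix (Fin l) (Fin m) (Module.End ℝ (SmoothFun D))} (hB : IsRingOperator hD B)
    (i : Fin l) (j : Fin m) : B i j ∈ fieldOps D H := by
  change B i j ∈ fieldOpsAlg D H hD hc hH
  have hp : ∀ i, partialOp hD i ∈ fieldOpsAlg D H hD hc hH :=
    partialOp_mem_fieldOps hD hc hH
  have hm : ∀ f, mulOp f ∈ fieldOpsAlg D H hD hc hH := mulOp_mem_fieldOps
  rcases hB with ⟨p, rfl⟩ | ⟨n, f, p, rfl⟩ | ⟨A, hA, p, rfl⟩
  · refine Subalgebra.sum_mem _ fun α _ => Subalgebra.smul_mem _ (list_prod_mem ?_) _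
    intro T hT
    obtain ⟨k, rfl⟩ := (List.mem_ofFn' _ _).1 hT
    exact Subalgebra.pow_mem _ (hp k) _
  · exact hm _
  -- An element of the Weyl algebra acts through any representative in the free algebra, so the
  -- generators suffice.
  · obtain ⟨a, hap⟩ := RingQuot.mkAlgHom_surjective ℝ (WeylRel hD A hA) (p i j)
    rw [Matrix.map_apply, ← hap, weylAction, RingQuot.liftAlgHom_mkAlgHom_apply]
    clear hap
    induction a using FreeAlgebra.induction with
    | grade0 r => simp
    | grade1 x =>
      rcases x with a | k
      · simpa [freeAction] using hm a
      · simpa [freeAction] using hp k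
    | mul a b ha hb => simpa using Subalgebra.mul_mem _ ha hb
    | add a b ha hb => simpa using Subalgebra.add_mem _ ha hb

end Fields
-- Gaussianity of processes in `H`, and matrices of operators.
section Pushforward

variable {d : ℕ} {D : Set (Eucl d)} {Ω : Type*} [MeasurableSpace Ω] {P : Measure Ω}

/-- Every element of the linear span of a Gaussian family has a Gaussian law. -/
lemma hasGaussianLaw_of_mem_span {T : Type*} {X : T → Ω → ℝ} (hX : IsGaussianProcess X P)
    {G : T → Lp ℝ 2 P} (hG : ∀ t, X t =ᵐ[P] G t) {u : Lp ℝ 2 P}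
    (hu : u ∈ Submodule.span ℝ (Set.range G)) : HasGaussianLaw u P := by
  obtain ⟨c, rfl⟩ := Finsupp.mem_span_range_iff_exists_finsupp.1 hu
  refine ((hX.smul c).hasGaussianLaw_fun_sum (I := c.support)).congr ?_
  exact ae_eq_sum _ fun t => ae_eq_smul _ (hG t)

/-- A process whose components belong to a Gaussian subspace of `L²` is Gaussian. -/
lemma isGaussianProcess_of_mem {H : Submodule ℝ (Lp ℝ 2 P)} (hH : ∀ u ∈ H, HasGaussianLaw u P)
    {T : Type*} {l : ℕ} {Y : T → Ω → Fin l → ℝ} {W : Fin l → T → Lp ℝ 2 P}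
    (hW : ∀ i x, W i x ∈ H) (hY : ∀ i x, (fun w => Y x w i) =ᵐ[P] W i x) :
    IsGaussianProcess Y P := by
  classical
  -- By the Cramér–Wold principle it suffices to treat linear functionals of finitely many values;
  -- each is a finite combination of components, hence in `H`.
  refine ⟨fun I => ⟨isGaussian_of_isGaussian_map fun L => ?_⟩⟩
  have hm : AEMeasurable (fun w => I.restrict (Y · w)) P :=
    aemeasurable_pi_lambda _ fun x => aemeasurable_pi_lambda _ fun i =>
      (Lp.aestronglyMeasurable (W i x)).aemeasurable.congr (hY i x).symm
  rw [AEMeasurable.map_map_of_aemeasurable (by fun_prop) hm]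
  have e : (L ∘ fun w => I.restrict (Y · w)) = fun w => ∑ x : I, ∑ i,
      L (Pi.single x (Pi.single i 1)) * Y x w i := by
    ext w
    have hv : I.restrict (Y · w) = ∑ x : I, ∑ i : Fin l,
        Y x w i • (Pi.single x (Pi.single i (1 : ℝ)) : I → Fin l → ℝ) := by
      ext x i
      simp [Finset.sum_apply, Pi.single_apply, apply_ite, ite_apply]
    rw [Function.comp_apply, hv]
    simp [mul_comm]
  rw [e]
  have hmem : ∑ x : I, ∑ i, L (Pi.single x (Pi.single i 1)) • W i x ∈ H :=
    H.sum_mem fun x _ => H.sum_mem fun i _ => H.smul_mem _ (hW i x)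
  exact ((hH _ hmem).congr (ae_eq_sum _ fun x : I => ae_eq_sum _ fun i =>
    ae_eq_smul _ (hY i x)).symm).isGaussian_map

/-- A matrix of operators in `fieldOps` maps vectors of fields to vectors of fields, and commutes
with continuous linear functionals. -/
lemma exists_field_applyOp {H : Submodule ℝ (Lp ℝ 2 P)} {l m : ℕ} {B : Matrix (Fin l) (Fin m) (Module.End ℝ (SmoothFun D))}
    (hB : ∀ i j, B i j ∈ fieldOps D H) {h : Fin m → Ω → SmoothFun D}
    {U : Fin m → D → Lp ℝ 2 P} (hU : ∀ j, IsField H (h j) (U j)) :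
    ∃ W : Fin l → D → Lp ℝ 2 P, (∀ i, IsField H (fun w => ∑ j, B i j (h j w)) (W i)) ∧
      ∀ φ : Lp ℝ 2 P →L[ℝ] ℝ, (∀ j, (fun x => φ (U j x)) ∈ SmoothFun D) → ∀ x i,
        applyOp B (fun x j => φ (U j x)) x i = φ (W i x) := by
  choose V hV hφV using fun i j => hB i j (h j) (U j) (hU j)
  refine ⟨fun i x => ∑ j, V i j x, fun i => ⟨fun x => H.sum_mem fun j _ => (hV i j).mem x,
    fun x => ?_⟩, fun φ hφ x i => ?_⟩
  · simpa using ae_eq_sum Finset.univ fun j => (hV i j).ae_eq x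
  · rw [applyOp, dif_pos hφ]
    simp [hφV _ _ φ]

end Pushforward

end GPPush

/-! ### The main theorem. -/

open GPPush in
theorem mainTheorem4 {d : ℕ} (D : Set (GPPush.Eucl d)) (hDc : IsCompact D)
    (hD : D ⊆ closure (interior D)) {l m : ℕ}
    (B : Matrix (Fin l) (Fin m) (Module.End ℝ (GPPush.SmoothFun D)))
    (hB : GPPush.IsRingOperator hD B)
    {Ω : Type*} [MeasurableSpace Ω] (P : MeasureTheory.Measure Ω)
    [MeasureTheory.IsProbabilityMeasure P]
    (g : D → Ω → Fin m → ℝ) (μ : D → Fin m → ℝ) (k : D → D → Matrix (Fin m) (Fin m) ℝ)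
    (hg : GPPush.IsGP P g μ k)
    (hreal : ∀ᵐ w ∂P, ∀ j, (fun x => g x w j) ∈ GPPush.SmoothFun D) :
    (∀ j, (fun x => μ x j) ∈ GPPush.SmoothFun D) ∧
    (∀ x' a b, (fun x => k x x' a b) ∈ GPPush.SmoothFun D) ∧
    (∀ x i b, (fun x' => GPPush.leftApply B k x x' i b) ∈ GPPush.SmoothFun D) ∧
    GPPush.IsGP P (GPPush.pushforward B g) (GPPush.applyOp B μ)
      (GPPush.rightApply B (GPPush.leftApply B k)) := by
  classical
  -- Indexing by points and components turns `g` into a scalar Gaussian family.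
  have hgauss : IsGaussianProcess (fun (t : D × Fin m) w => g t.1 w t.2) P :=
    hg.gaussian.of_isGaussianProcess fun t => ⟨{t.1},
      (ContinuousLinearMap.proj (R := ℝ) (φ := fun _ : Fin m => ℝ) t.2).comp
        (ContinuousLinearMap.proj (R := ℝ) (φ := fun _ : ({t.1} : Finset D) => Fin m → ℝ)
          ⟨t.1, by simp⟩), fun w => rfl⟩
  have hL2 : ∀ t : D × Fin m, MemLp (fun w => g t.1 w t.2) 2 P := fun t =>
    (hgauss.hasGaussianLaw_eval t).memLp_two
  let U : Fin m → D → Lp ℝ 2 P := fun j x => (hL2 (x, j)).toLp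
  have hUg : ∀ j x, (fun w => g x w j) =ᵐ[P] U j x := fun j x =>
    (hL2 (x, j)).coeFn_toLp.symm
  let S : Submodule ℝ (Lp ℝ 2 P) := Submodule.span ℝ (range fun t : D × Fin m => U t.2 t.1)
  let H := S.topologicalClosure
  have hc : IsClosed (H : Set (Lp ℝ 2 P)) := S.isClosed_topologicalClosure
  have hH : ∀ u ∈ H, HasGaussianLaw u P := fun u hu =>
    closure_minimal (t := {u : Lp ℝ 2 P | HasGaussianLaw u P})
      (fun v hv => hasGaussianLaw_of_mem_span hgauss (fun t => hUg t.2 t.1) hv)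
      isClosed_hasGaussianLaw hu
  -- Setting `h` to `0` on the exceptional null set makes every path smooth without changing the
  -- `L²` classes.
  let h : Fin m → Ω → SmoothFun D := fun j w =>
    if hw : (fun x => g x w j) ∈ SmoothFun D then ⟨_, hw⟩ else 0
  have hU : ∀ j, IsField H (h j) (U j) := fun j => by
    refine ⟨fun x => S.le_topologicalClosure (Submodule.subset_span ⟨(x, j), rfl⟩), fun x => ?_⟩
    refine Filter.EventuallyEq.trans ?_ (hUg j x)
    filter_upwards [hreal] with w hw
    simp [h, dif_pos (hw j)]
  have hsm : ∀ (φ : Lp ℝ 2 P →L[ℝ] ℝ) j, (fun x => φ (U j x)) ∈ SmoothFun D := fun φ j =>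
    (hU j).mem_smoothFun hD hc hH φ
  obtain ⟨W, hW, hφW⟩ :=
    exists_field_applyOp (fun i j => isRingOperator_mem_fieldOps hD hc hH hB i j) hU
  have hpush : ∀ i x, (fun w => pushforward B g x w i) =ᵐ[P] W i x := fun i x => by
    refine Filter.EventuallyEq.trans ?_ ((hW i).ae_eq x)
    filter_upwards [hreal] with w hw
    rw [pushforward, applyOp, dif_pos hw]
    simp [h, dif_pos (hw _)]
  have hμ : μ = fun x j => expL2 P (U j x) := by
    ext x j
    rw [← hg.mean, expL2_apply]
    exact integral_congr_ae (hUg j x)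
  -- The variable `x'` is put into the functional, so that `B` in `x` acts on its argument; the
  -- symmetry of `covL2` later exchanges the roles for `B'`.
  have hk : ∀ x x' a b, k x x' a b = covL2 (U b x') (U a x) := fun x x' a b => by
    rw [← hg.cov, hμ, covL2_apply]
    refine integral_congr_ae ?_
    filter_upwards [hUg a x, hUg b x'] with w h1 h2
    rw [h1, h2, mul_comm]
  have hleft : ∀ x x' i b, leftApply B k x x' i b = covL2 (W i x) (U b x') := fun x x' i b => by
    simp only [leftApply, hk, Matrix.of_apply]
    rw [hφW _ (hsm _), covL2_comm]
  have hright : ∀ x x' i j,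
      rightApply B (leftApply B k) x x' i j = covL2 (W i x) (W j x') := fun x x' i j => by
    rw [rightApply, Matrix.of_apply]
    simp only [hleft]
    rw [hφW _ (hsm _)]
  have hmean : ∀ x i, applyOp B μ x i = expL2 P (W i x) := fun x i => by
    rw [hμ, hφW _ (hsm _)]
  refine ⟨fun j => ?_, fun x' a b => ?_, fun x i b => ?_,
    isGaussianProcess_of_mem hH (fun i => (hW i).mem) hpush, fun x i => ?_, fun x x' i j => ?_⟩
  · rw [hμ]
    exact hsm _ j
  · simp only [hk]
    exact hsm _ a
  · simp only [hleft]
    exact hsm _ b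
  · rw [hmean, expL2_apply]
    exact integral_congr_ae (hpush i x)
  · rw [hright, hmean, hmean, covL2_apply]
    refine integral_congr_ae ?_
    filter_upwards [hpush i x, hpush j x'] with w h1 h2
    rw [h1, h2]
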